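/- Let $\Bbbk$ be a field of characteristic zero, let $n \ge 5$ be an odd integer, and let $S = \Bbbk[x_1,\ldots,x_n]$ with the standard grading. Let $I \subset S$ be an ideal that is minimally generated by $n+2$ monomials of degree $2$ and such that the quotient $A = S/I = \bigoplus_{i \ge 0} A_i$ is artinian. Then $A$ has the weak Lefschetz property (WLP): there is a linear form $\ell \in A_1$ such that for every $i \ge 0$ the multiplication map $\times \ell : A_i \to A_{i+1}$ is injective or surjective. -/

import Mathlib

open MvPolynomial

noncomputable section

/-- The graded piece of degree `i` of `k[x_1, …, x_n] / I`, for a homogeneous ideal `I` and the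
standard grading: the classes of the homogeneous polynomials of degree `i`. -/
def quotPiece {k : Type*} [Field k] {n : ℕ} (I : Ideal (MvPolynomial (Fin n) k)) (i : ℕ) :
    Submodule k (MvPolynomial (Fin n) k ⧸ I) :=
  (homogeneousSubmodule (Fin n) k i).map (Ideal.Quotient.mkₐ k I).toLinearMap

theorem quotPiece_mul_mem {k : Type*} [Field k] {n : ℕ} {I : Ideal (MvPolynomial (Fin n) k)}
    {i : ℕ} {l a : MvPolynomial (Fin n) k ⧸ I} (hl : l ∈ quotPiece I 1) (ha : a ∈ quotPiece I i) :
    l * a ∈ quotPiece I (i + 1) := by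
  obtain ⟨p, hp, rfl⟩ := hl
  obtain ⟨q, hq, rfl⟩ := ha
  refine ⟨p * q, ?_, map_mul (Ideal.Quotient.mkₐ k I) p q⟩
  have h : (p * q).IsHomogeneous (1 + i) := IsHomogeneous.mul hp hq
  rw [add_comm] at h
  exact h

/-- Multiplication by a linear form `l`, as a `k`-linear map from the piece of degree `i` to the
piece of degree `i + 1`. -/
def mulLinearForm {k : Type*} [Field k] {n : ℕ} (I : Ideal (MvPolynomial (Fin n) k))
    (l : MvPolynomial (Fin n) k ⧸ I) (hl : l ∈ quotPiece I 1) (i : ℕ) :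
    quotPiece I i →ₗ[k] quotPiece I (i + 1) :=
  (LinearMap.mulLeft k l).restrict fun _ ha => quotPiece_mul_mem hl ha

/-- The weak Lefschetz property of `k[x_1, …, x_n] / I`, for a homogeneous ideal `I`: there is a
linear form such that multiplication by it has maximal rank in every degree, that is, each map
from the piece of degree `i` to the piece of degree `i + 1` is injective or surjective. -/
def HasWLP {k : Type*} [Field k] {n : ℕ} (I : Ideal (MvPolynomial (Fin n) k)) : Prop :=
  ∃ (l : MvPolynomial (Fin n) k ⧸ I) (hl : l ∈ quotPiece I 1), ∀ i : ℕ,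
    Function.Injective (mulLinearForm I l hl i) ∨ Function.Surjective (mulLinearForm I l hl i)

/-- The ideal generated by the monomials with exponent vectors in `G`. -/
def monomialIdeal (k : Type*) [Field k] {n : ℕ} (G : Finset (Fin n →₀ ℕ)) :
    Ideal (MvPolynomial (Fin n) k) :=
  Ideal.span ((fun m => monomial m (1 : k)) '' (G : Set (Fin n →₀ ℕ)))

/-- `I` is minimally generated by `μ` monomials of degree `d`: some set of `μ` monomials of degree
`d` generates `I`, and no proper subset of it does. -/
def IsMinGenByMonomials {k : Type*} [Field k] {n : ℕ} (I : Ideal (MvPolynomial (Fin n) k))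
    (μ d : ℕ) : Prop :=
  ∃ G : Finset (Fin n →₀ ℕ), G.card = μ ∧ (∀ m ∈ G, m.degree = d) ∧
    monomialIdeal k G = I ∧ ∀ G' : Finset (Fin n →₀ ℕ), G' ⊂ G → monomialIdeal k G' ≠ I

end

/-!
Since `S / I` is artinian, some power of each variable is a generator of `I`, necessarily `x_j ^ 2`.
The two remaining generators are squarefree quadrics, hence the edges of a graph `Γ` on the
variables. So `S / I` has the independent sets of `Γ` as a basis, and `ℓ = ∑ x_j` acts on it
as the up operator `S ↦ ∑ (S ∪ {v})` of the independence complex of `Γ`.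

For a complex consisting of all subsets of an `N`-set, the up operator from `i`-sets to
`(i + 1)`-sets is the raising operator of a representation of `sl₂` in which `i`-sets have weight
`2 i - N`; it is therefore injective for `2 i < N` and surjective for `N < 2 (i + 1)`. For a general
complex, injectivity and surjectivity follow from those of the deletion and of the link of a vertex.

If the two edges share a vertex, deletion and link of this vertex are full subset complexes and one
step suffices. If they are disjoint, two steps give injectivity for `2 i + 2 < n` and surjectivity
for `n < 2 i + 2`; the missing case `n = 2 i + 2` is excluded because `n` is odd.
-/

noncomputable section

section Sl2

/-- The defining relations of `sl₂` for three endomorphisms of a module. Unlike `IsSl2Triple`, this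
allows `h = 0`, as for the functions on the subsets of an empty set. -/
structure IsSl2Action {R M : Type*} [CommRing R] [AddCommGroup M] [Module R M]
    (h e f : Module.End R M) : Prop where
  e_mul_f : e * f - f * e = h
  h_mul_e : h * e - e * h = 2 • e
  h_mul_f : h * f - f * h = -(2 • f)

namespace IsSl2Action

section CommRing

variable {R M : Type*} [CommRing R] [AddCommGroup M] [Module R M] {h e f : Module.End R M}
  {v : M} {μ : R}

theorem e_f_apply (t : IsSl2Action h e f) (v : M) : e (f v) = f (e v) + h v := by
  have := LinearMap.congr_fun t.e_mul_f v
  rw [← this, LinearMap.sub_apply, Module.End.mul_apply, Module.End.mul_apply]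
  abel

theorem h_e_apply (t : IsSl2Action h e f) (hv : h v = μ • v) : h (e v) = (μ + 2) • e v := by
  have := LinearMap.congr_fun t.h_mul_e v
  rw [LinearMap.sub_apply, Module.End.mul_apply, Module.End.mul_apply, hv, map_smul,
    sub_eq_iff_eq_add] at this
  rw [this, LinearMap.smul_apply]
  module

theorem h_f_apply (t : IsSl2Action h e f) (hv : h v = μ • v) : h (f v) = (μ - 2) • f v := by
  have := LinearMap.congr_fun t.h_mul_f v
  rw [LinearMap.sub_apply, Module.End.mul_apply, Module.End.mul_apply, hv, map_smul,
    sub_eq_iff_eq_add] at this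
  rw [this, LinearMap.neg_apply, LinearMap.smul_apply]
  module

theorem h_e_pow_apply (t : IsSl2Action h e f) (hv : h v = μ • v) (j : ℕ) :
    h ((e ^ j) v) = (μ + 2 * j) • (e ^ j) v := by
  induction j with
  | zero => simpa using hv
  | succ j ih =>
    rw [pow_succ', Module.End.mul_apply, t.h_e_apply ih]
    congr 1
    push_cast
    ring

theorem h_f_pow_apply (t : IsSl2Action h e f) (hv : h v = μ • v) (j : ℕ) :
    h ((f ^ j) v) = (μ - 2 * j) • (f ^ j) v := by
  induction j with
  | zero => simpa using hv
  | succ j ih =>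
    rw [pow_succ', Module.End.mul_apply, t.h_f_apply ih]
    congr 1
    push_cast
    ring

theorem e_f_pow_succ_apply (t : IsSl2Action h e f) (hv : h v = μ • v) (j : ℕ) :
    e ((f ^ (j + 1)) v) = (f ^ (j + 1)) (e v) + ((j + 1) * (μ - j)) • (f ^ j) v := by
  induction j with
  | zero => simp [t.e_f_apply, hv]
  | succ j ih =>
    have hf_pow (l : ℕ) (w : M) : f ((f ^ l) w) = (f ^ (l + 1)) w := by
      rw [pow_succ', Module.End.mul_apply]
    rw [← hf_pow, t.e_f_apply, ih, t.h_f_pow_apply hv, map_add, map_smul, hf_pow, hf_pow]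
    push_cast
    module

end CommRing

variable {K M : Type*} [Field K] [AddCommGroup M] [Module K M] {h e f : Module.End K M}
  {v : M} {μ : K} {m : ℕ}

theorem eq_zero_of_e_apply_eq_zero (t : IsSl2Action h e f) (hv : h v = μ • v)
    (hfm : (f ^ m) v = 0) (hμ : ∀ j < m, (j + 1) * (μ - j) ≠ 0) (hev : e v = 0) : v = 0 := by
  induction m with
  | zero => simpa using hfm
  | succ m ih =>
    refine ih ?_ fun j hj => hμ j (hj.trans m.lt_succ_self)
    have key := t.e_f_pow_succ_apply hv m
    rw [hfm, hev, map_zero, map_zero, zero_add] at key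
    exact (smul_eq_zero.1 key.symm).resolve_left (hμ m m.lt_succ_self)

theorem mem_range_e_of_f_pow_e_pow_mem (t : IsSl2Action h e f) (hv : h v = μ • v)
    (hm : (f ^ m) ((e ^ m) v) ∈ LinearMap.range e) (hμ : ∀ j < m, (j + 1) * (μ + j) ≠ 0) :
    v ∈ LinearMap.range e := by
  induction m with
  | zero => simpa using hm
  | succ m ih =>
    refine ih ?_ fun j hj => hμ j (hj.trans m.lt_succ_self)
    have key := t.e_f_pow_succ_apply (t.h_e_pow_apply hv m) m
    rw [← Module.End.mul_apply e (e ^ m), ← pow_succ', ← sub_eq_iff_eq_add',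
      show μ + 2 * m - m = μ + m by ring] at key
    rw [← Submodule.smul_mem_iff _ (hμ m m.lt_succ_self), ← key]
    exact sub_mem (LinearMap.mem_range_self e _) hm

end IsSl2Action

end Sl2

section BooleanLattice

open Finset

theorem natCast_ne_zero_of_factorial_ne_zero {R : Type*} [Semiring R] {N m : ℕ}
    (hN : (N.factorial : R) ≠ 0) (hm : 0 < m) (hmN : m ≤ N) : (m : R) ≠ 0 := by
  obtain ⟨c, hc⟩ := Nat.dvd_factorial hm hmN
  intro h
  rw [hc, Nat.cast_mul, h, zero_mul] at hN
  exact hN rfl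

theorem factorial_card_ne_zero_of_subset {α R : Type*} [Semiring R] {V W : Finset α}
    (hWV : W ⊆ V) (hV : ((#V).factorial : R) ≠ 0) : ((#W).factorial : R) ≠ 0 := by
  obtain ⟨c, hc⟩ := Nat.factorial_dvd_factorial (card_le_card hWV)
  intro h
  rw [hc, Nat.cast_mul, h, zero_mul] at hV
  exact hV rfl

section Layer

variable {α R : Type*} [CommRing R]

/-- The functions supported on the subsets of `V` of size `i`. -/
def layer (R : Type*) [CommRing R] (V : Finset α) (i : ℕ) : Submodule R (Finset α → R) where
  carrier := {g | ∀ S ∉ V.powersetCard i, g S = 0}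
  add_mem' hg hg' S hS := by rw [Pi.add_apply, hg S hS, hg' S hS, add_zero]
  zero_mem' _ _ := rfl
  smul_mem' c g hg S hS := by rw [Pi.smul_apply, hg S hS, smul_zero]

theorem indicator_mem_layer (V : Finset α) (i : ℕ) (g : Finset α → R) :
    (V.powersetCard i : Set (Finset α)).indicator g ∈ layer R V i := fun _ hS =>
  Set.indicator_of_notMem (mt mem_coe.1 hS) g

theorem eq_zero_of_mem_layer {V : Finset α} {i : ℕ} {g : Finset α → R} (hi : #V < i)
    (hg : g ∈ layer R V i) : g = 0 :=
  funext fun S => hg S (by simp [powersetCard_eq_empty.2 hi])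

end Layer

variable {α R : Type*} [DecidableEq α] [CommRing R]

/-- The operator on functions of finite sets that sums over the sets obtained by removing one
element of `V`; on the monomial basis of `R[x_v : v ∈ V] / (x_v ^ 2)` it is multiplication by
`∑ v ∈ V, x_v`. -/
def raise (R : Type*) [CommRing R] (V : Finset α) : Module.End R (Finset α → R) where
  toFun g S := ∑ v ∈ V ∩ S, g (S.erase v)
  map_add' _ _ := funext fun _ => sum_add_distrib
  map_smul' _ _ := funext fun _ => (mul_sum ..).symm

/-- The operator on functions of finite sets that sums over the sets obtained by adding one element
of `V`. -/
def lower (R : Type*) [CommRing R] (V : Finset α) : Module.End R (Finset α → R) where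
  toFun g S := ∑ v ∈ V \ S, g (insert v S)
  map_add' _ _ := funext fun _ => sum_add_distrib
  map_smul' _ _ := funext fun _ => (mul_sum ..).symm

/-- The diagonal operator whose eigenvalue at `S` is the number of elements of `V` in `S` minus the
number of those outside `S`. -/
def weight (R : Type*) [CommRing R] (V : Finset α) : Module.End R (Finset α → R) where
  toFun g S := (#(V ∩ S) - #(V \ S) : R) * g S
  map_add' _ _ := funext fun _ => mul_add ..
  map_smul' _ _ := funext fun _ => mul_left_comm ..

theorem raise_apply (V : Finset α) (g : Finset α → R) (S : Finset α) :
    raise R V g S = ∑ v ∈ V ∩ S, g (S.erase v) := rfl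

theorem lower_apply (V : Finset α) (g : Finset α → R) (S : Finset α) :
    lower R V g S = ∑ v ∈ V \ S, g (insert v S) := rfl

theorem weight_apply (V : Finset α) (g : Finset α → R) (S : Finset α) :
    weight R V g S = (#(V ∩ S) - #(V \ S) : R) * g S := rfl

theorem raise_lower_apply (V : Finset α) (g : Finset α → R) (S : Finset α) :
    raise R V (lower R V g) S =
      #(V ∩ S) * g S + ∑ v ∈ V ∩ S, ∑ w ∈ V \ S, g (insert w (S.erase v)) := by
  rw [raise_apply, ← nsmul_eq_mul, ← sum_const, ← sum_add_distrib]
  refine sum_congr rfl fun v hv => ?_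
  obtain ⟨hvV, hvS⟩ := mem_inter.1 hv
  rw [lower_apply, sdiff_erase hvV, sum_insert (by simp [hvS]), insert_erase hvS]

theorem lower_raise_apply (V : Finset α) (g : Finset α → R) (S : Finset α) :
    lower R V (raise R V g) S =
      #(V \ S) * g S + ∑ w ∈ V \ S, ∑ v ∈ V ∩ S, g ((insert w S).erase v) := by
  rw [lower_apply, ← nsmul_eq_mul, ← sum_const, ← sum_add_distrib]
  refine sum_congr rfl fun w hw => ?_
  obtain ⟨hwV, hwS⟩ := mem_sdiff.1 hw
  rw [raise_apply, inter_insert_of_mem hwV, sum_insert (by simp [hwS]), erase_insert hwS]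

theorem isSl2Action_weight_raise_lower (V : Finset α) :
    IsSl2Action (weight R V) (raise R V) (lower R V) where
  e_mul_f := by
    ext g S
    have hcomm : ∑ v ∈ V ∩ S, ∑ w ∈ V \ S, g (insert w (S.erase v)) =
        ∑ w ∈ V \ S, ∑ v ∈ V ∩ S, g ((insert w S).erase v) := by
      rw [sum_comm]
      refine sum_congr rfl fun w hw => sum_congr rfl fun v hv => ?_
      have hwv : w ≠ v := by
        rintro rfl
        exact (mem_sdiff.1 hw).2 (mem_inter.1 hv).2
      rw [erase_insert_of_ne hwv]
    rw [LinearMap.sub_apply, Module.End.mul_apply, Module.End.mul_apply, Pi.sub_apply,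
      raise_lower_apply, lower_raise_apply, hcomm, weight_apply]
    ring
  h_mul_e := by
    ext g S
    simp only [LinearMap.sub_apply, Module.End.mul_apply, Pi.sub_apply, LinearMap.smul_apply,
      Pi.smul_apply, weight_apply, raise_apply, mul_sum, smul_sum, ← sum_sub_distrib]
    refine sum_congr rfl fun v hv => ?_
    obtain ⟨hvV, hvS⟩ := mem_inter.1 hv
    have hi : #(V ∩ S) = #(V ∩ S.erase v) + 1 := by
      rw [inter_erase, card_erase_add_one hv]
    have hd : #(V \ S.erase v) = #(V \ S) + 1 := by
      rw [sdiff_erase hvV, card_insert_of_notMem (by simp [hvS])]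
    rw [hi, hd, nsmul_eq_mul]
    push_cast
    ring
  h_mul_f := by
    ext g S
    simp only [LinearMap.sub_apply, Module.End.mul_apply, Pi.sub_apply, LinearMap.neg_apply,
      LinearMap.smul_apply, Pi.neg_apply, Pi.smul_apply, weight_apply, lower_apply, mul_sum,
      smul_sum, ← sum_sub_distrib, ← sum_neg_distrib]
    refine sum_congr rfl fun v hv => ?_
    obtain ⟨hvV, hvS⟩ := mem_sdiff.1 hv
    have hi : #(V ∩ insert v S) = #(V ∩ S) + 1 := by
      rw [inter_insert_of_mem hvV, card_insert_of_notMem (by simp [hvS])]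
    have hd : #(V \ S) = #(V \ insert v S) + 1 := by
      rw [sdiff_insert, card_erase_add_one hv]
    rw [hi, hd, nsmul_eq_mul]
    push_cast
    ring

variable {V : Finset α} {i : ℕ} {g : Finset α → R}

theorem weight_eq_smul_of_mem_layer (hg : g ∈ layer R V i) :
    weight R V g = (2 * i - #V : R) • g := by
  ext S
  by_cases hS : S ∈ V.powersetCard i
  · obtain ⟨hSV, rfl⟩ := mem_powersetCard.1 hS
    rw [weight_apply, inter_eq_right.2 hSV, ← card_sdiff_add_card_eq_card hSV, Pi.smul_apply,
      smul_eq_mul]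
    push_cast
    ring
  · rw [weight_apply, Pi.smul_apply, hg S hS, mul_zero, smul_zero]

theorem raise_mem_layer (hg : g ∈ layer R V i) : raise R V g ∈ layer R V (i + 1) := by
  refine fun S hS => sum_eq_zero fun v hv => hg _ fun hSv => hS ?_
  obtain ⟨hvV, hvS⟩ := mem_inter.1 hv
  obtain ⟨hsub, hcard⟩ := mem_powersetCard.1 hSv
  rw [mem_powersetCard, ← hcard, card_erase_add_one hvS, ← insert_erase hvS]
  exact ⟨insert_subset hvV hsub, rfl⟩

theorem lower_mem_layer (hg : g ∈ layer R V (i + 1)) : lower R V g ∈ layer R V i := by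
  refine fun S hS => sum_eq_zero fun v hv => hg _ fun hSv => hS ?_
  obtain ⟨hsub, hcard⟩ := mem_powersetCard.1 hSv
  rw [card_insert_of_notMem (mem_sdiff.1 hv).2, Nat.add_right_cancel_iff] at hcard
  exact mem_powersetCard.2 ⟨(subset_insert v S).trans hsub, hcard⟩

theorem lower_eq_zero_of_mem_layer_zero (hg : g ∈ layer R V 0) : lower R V g = 0 :=
  funext fun S => sum_eq_zero fun v _ => hg _ (by simp)

theorem raise_pow_mem_layer (hg : g ∈ layer R V i) (m : ℕ) :
    (raise R V ^ m) g ∈ layer R V (i + m) := by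
  induction m with
  | zero => exact hg
  | succ m ih =>
    rw [pow_succ', Module.End.mul_apply]
    exact raise_mem_layer ih

theorem lower_pow_eq_zero (hg : g ∈ layer R V i) : (lower R V ^ (i + 1)) g = 0 := by
  induction i generalizing g with
  | zero => simpa using lower_eq_zero_of_mem_layer_zero hg
  | succ i ih => exact ih (lower_mem_layer hg)

variable {k : Type*} [Field k]

theorem eq_zero_of_raise_eq_zero (hV : ((#V).factorial : k) ≠ 0) (hi : 2 * i < #V)
    {g : Finset α → k} (hg : g ∈ layer k V i) (h0 : raise k V g = 0) : g = 0 := by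
  refine (isSl2Action_weight_raise_lower V).eq_zero_of_e_apply_eq_zero
    (weight_eq_smul_of_mem_layer hg) (lower_pow_eq_zero hg) (fun j hj => ?_) h0
  have hweight : (2 * i - #V - j : k) = -((#V + j - 2 * i : ℕ) : k) := by
    rw [Nat.cast_sub (by omega)]
    push_cast
    ring
  rw [hweight]
  exact mul_ne_zero (mod_cast natCast_ne_zero_of_factorial_ne_zero hV j.succ_pos (by omega))
    (neg_ne_zero.2 (natCast_ne_zero_of_factorial_ne_zero hV (by omega) (by omega)))

theorem mem_range_raise (hV : ((#V).factorial : k) ≠ 0) (hi : #V < 2 * i)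
    {g : Finset α → k} (hg : g ∈ layer k V i) : g ∈ LinearMap.range (raise k V) := by
  have hpow : (raise k V ^ (#V + 1 - i)) g = 0 :=
    eq_zero_of_mem_layer (by omega) (raise_pow_mem_layer hg _)
  refine (isSl2Action_weight_raise_lower V).mem_range_e_of_f_pow_e_pow_mem
    (weight_eq_smul_of_mem_layer hg) (m := #V + 1 - i) (by simp [hpow]) fun j hj => ?_
  have hweight : (2 * i - #V + j : k) = ((2 * i + j - #V : ℕ) : k) := by
    rw [Nat.cast_sub (by omega)]
    push_cast
    ring
  rw [hweight]
  exact mul_ne_zero (mod_cast natCast_ne_zero_of_factorial_ne_zero hV j.succ_pos (by omega))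
    (natCast_ne_zero_of_factorial_ne_zero hV (by omega) (by omega))

end BooleanLattice

section UpOperator

open Finset

variable {α R : Type*} [DecidableEq α] [CommRing R] {F : Set (Finset α)} {x : α} {i : ℕ}

/-- The up operator from the `i`-sets to the `(i + 1)`-sets of the family `F`, which sends `f` to
`T ↦ ∑ v ∈ T, f (T.erase v)`, is injective. The family is thought of as closed under subsets, and
only the values of `f` on `F` matter. -/
def UpInjective (R : Type*) [CommRing R] (F : Set (Finset α)) (i : ℕ) : Prop :=
  ∀ f : Finset α → R, (∀ T ∈ F, #T = i + 1 → ∑ v ∈ T, f (T.erase v) = 0) → ∀ S ∈ F, #S = i → f S = 0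

/-- The up operator from the `i`-sets to the `(i + 1)`-sets of the family `F` is surjective; see
`UpInjective`. -/
def UpSurjective (R : Type*) [CommRing R] (F : Set (Finset α)) (i : ℕ) : Prop :=
  ∀ g : Finset α → R, ∃ f : Finset α → R, ∀ T ∈ F, #T = i + 1 → ∑ v ∈ T, f (T.erase v) = g T

/-- The deletion of the vertex `x` from the simplicial complex `F`. -/
def deletion (F : Set (Finset α)) (x : α) : Set (Finset α) := {S | x ∉ S ∧ S ∈ F}

/-- The link of the vertex `x` in the simplicial complex `F`. -/
def vertexLink (F : Set (Finset α)) (x : α) : Set (Finset α) := {S | x ∉ S ∧ insert x S ∈ F}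

theorem sum_erase_insert {x : α} {S : Finset α} (hx : x ∉ S) (f : Finset α → R) :
    ∑ v ∈ insert x S, f ((insert x S).erase v) = f S + ∑ v ∈ S, f (insert x (S.erase v)) := by
  rw [sum_insert hx, erase_insert hx]
  congr 1
  refine sum_congr rfl fun v hv => ?_
  rw [erase_insert_of_ne (ne_of_mem_of_not_mem hv hx).symm]

theorem UpInjective.of_deletion_vertexLink (hF : ∀ S, insert x S ∈ F → S ∈ F)
    (hd : UpInjective R (deletion F x) i)
    (hl : ∀ j, j + 1 = i → UpInjective R (vertexLink F x) j) : UpInjective R F i := by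
  intro f hf
  have hdel : ∀ S ∈ deletion F x, #S = i → f S = 0 := hd f fun T hT => hf T hT.2
  intro S hS hSi
  by_cases hx : x ∈ S
  · obtain ⟨S, hxS, rfl⟩ : ∃ S', x ∉ S' ∧ insert x S' = S :=
      ⟨S.erase x, notMem_erase x S, insert_erase hx⟩
    rw [card_insert_of_notMem hxS] at hSi
    refine hl #S hSi (fun T => f (insert x T)) (fun T hT hTc => ?_) S ⟨hxS, hS⟩ rfl
    have hsum := hf _ hT.2 (by rw [card_insert_of_notMem hT.1]; omega)
    rwa [sum_erase_insert hT.1, hdel T ⟨hT.1, hF T hT.2⟩ (hTc.trans hSi), zero_add] at hsum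
  · exact hdel S ⟨hx, hS⟩ hSi

theorem UpSurjective.of_deletion_vertexLink (hd : UpSurjective R (deletion F x) (i + 1))
    (hl : UpSurjective R (vertexLink F x) i) : UpSurjective R F (i + 1) := by
  intro g
  obtain ⟨f, hf⟩ := hd g
  obtain ⟨f', hf'⟩ := hl fun S => g (insert x S) - f S
  refine ⟨fun S => if x ∈ S then f' (S.erase x) else f S, fun T hT hTc => ?_⟩
  by_cases hx : x ∈ T
  · obtain ⟨S, hxS, rfl⟩ : ∃ S, x ∉ S ∧ insert x S = T :=
      ⟨T.erase x, notMem_erase x T, insert_erase hx⟩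
    rw [card_insert_of_notMem hxS] at hTc
    rw [sum_erase_insert hxS fun S => if x ∈ S then f' (S.erase x) else f S, if_neg hxS,
      ← eq_sub_iff_add_eq', ← hf' S ⟨hxS, hT⟩ (by omega)]
    refine sum_congr rfl fun v _ => ?_
    rw [if_pos (mem_insert_self _ _), erase_insert fun h => hxS (mem_of_mem_erase h)]
  · rw [← hf T ⟨hx, hT⟩ hTc]
    exact sum_congr rfl fun v _ => if_neg fun h => hx (mem_of_mem_erase h)

variable {k : Type*} [Field k] {V : Finset α}

theorem sum_erase_eq_raise_indicator {S : Finset α} (hS : S ∈ V.powersetCard (i + 1))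
    (f : Finset α → R) : ∑ v ∈ S, f (S.erase v) =
      raise R V ((V.powersetCard i : Set (Finset α)).indicator f) S := by
  obtain ⟨hSV, hSi⟩ := mem_powersetCard.1 hS
  rw [raise_apply, inter_eq_right.2 hSV]
  refine sum_congr rfl fun v hv => (Set.indicator_of_mem ?_ f).symm
  rw [mem_coe, mem_powersetCard, card_erase_of_mem hv, hSi]
  exact ⟨(erase_subset v S).trans hSV, rfl⟩

theorem upInjective_subsets (hV : ((#V).factorial : k) ≠ 0) (hi : 2 * i < #V) :
    UpInjective k {S | S ⊆ V} i := by
  intro f hf S hSV hSi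
  have hlayer := indicator_mem_layer V i f
  have hraise : raise k V ((V.powersetCard i : Set (Finset α)).indicator f) = 0 := by
    ext T
    by_cases hT : T ∈ V.powersetCard (i + 1)
    · rw [← sum_erase_eq_raise_indicator hT]
      exact hf T (mem_powersetCard.1 hT).1 (mem_powersetCard.1 hT).2
    · exact raise_mem_layer hlayer T hT
  have hS := congrFun (eq_zero_of_raise_eq_zero hV hi hlayer hraise) S
  rwa [Set.indicator_of_mem (mem_coe.2 (mem_powersetCard.2 ⟨hSV, hSi⟩))] at hS

theorem upSurjective_subsets (hV : ((#V).factorial : k) ≠ 0) (hi : #V < 2 * (i + 1)) :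
    UpSurjective k {S | S ⊆ V} i := by
  intro g
  obtain ⟨f, hf⟩ := mem_range_raise hV hi (indicator_mem_layer V (i + 1) g)
  refine ⟨f, fun T hTV hTi => ?_⟩
  have hT := congrFun hf T
  rwa [raise_apply, inter_eq_right.2 hTV,
    Set.indicator_of_mem (mem_coe.2 (mem_powersetCard.2 ⟨hTV, hTi⟩))] at hT

end UpOperator

section IndependenceComplex

open Finset

variable {α : Type*} {Γ : SimpleGraph α} {V : Finset α}

theorem isIndepSet_of_forall_edge {W : Set α} (h : ∀ e ∈ Γ.edgeSet, ∃ v ∈ e, v ∉ W) :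
    Γ.IsIndepSet W := by
  intro a ha b hb _ hab
  obtain ⟨v, hv, hvW⟩ := h s(a, b) hab
  rcases Sym2.mem_iff.1 hv with rfl | rfl
  exacts [hvW ha, hvW hb]

/-- The independence complex of the subgraph of `Γ` induced on `V`. -/
def indepComplex (Γ : SimpleGraph α) (V : Finset α) : Set (Finset α) :=
  {S | S ⊆ V ∧ Γ.IsIndepSet S}

theorem indepComplex_of_isIndepSet (hV : Γ.IsIndepSet V) : indepComplex Γ V = {S | S ⊆ V} :=
  Set.ext fun _ => and_iff_left_of_imp fun hS => hV.mono (coe_subset.2 hS)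

variable [DecidableEq α] {x : α}

theorem mem_indepComplex_of_insert_mem {S : Finset α} (h : insert x S ∈ indepComplex Γ V) :
    S ∈ indepComplex Γ V :=
  ⟨(subset_insert x S).trans h.1, h.2.mono (coe_subset.2 (subset_insert x S))⟩

theorem deletion_indepComplex (Γ : SimpleGraph α) (V : Finset α) (x : α) :
    deletion (indepComplex Γ V) x = indepComplex Γ (V.erase x) := by
  ext S
  simp only [deletion, indepComplex, Set.mem_ofPred_eq, subset_erase]
  tauto

variable [DecidableRel Γ.Adj] {i : ℕ} {k : Type*} [Field k]

theorem vertexLink_indepComplex (hx : x ∈ V) :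
    vertexLink (indepComplex Γ V) x = indepComplex Γ {v ∈ V.erase x | ¬ Γ.Adj x v} := by
  ext S
  simp only [vertexLink, indepComplex, Set.mem_ofPred_eq, coe_insert]
  refine ⟨fun ⟨hxS, hSV, hS⟩ => ⟨fun v hv => ?_, hS.mono (Set.subset_insert x S)⟩,
    fun ⟨hSV, hS⟩ => ⟨fun h => ?_, insert_subset hx fun v hv => ?_, ?_⟩⟩
  · have hvx : v ≠ x := ne_of_mem_of_not_mem hv hxS
    exact mem_filter.2 ⟨mem_erase.2 ⟨hvx, hSV (mem_insert_of_mem hv)⟩,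
      hS (Set.mem_insert x S) (Set.mem_insert_of_mem x hv) hvx.symm⟩
  · simpa using hSV h
  · exact mem_of_mem_erase (mem_filter.1 (hSV hv)).1
  · refine hS.insert fun v hv _ => ?_
    have hadj : ¬ Γ.Adj x v := (mem_filter.1 (hSV hv)).2
    exact ⟨hadj, fun h => hadj h.symm⟩

theorem card_nonneighbors_add_card_neighbors (hx : x ∈ V) :
    #{v ∈ V.erase x | ¬ Γ.Adj x v} + #{v ∈ V | Γ.Adj x v} + 1 = #V := by
  have hnbr : ({v ∈ V | Γ.Adj x v} : Finset α) = {v ∈ V.erase x | Γ.Adj x v} := by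
    ext v
    simp only [mem_filter, mem_erase]
    exact ⟨fun h => ⟨⟨h.2.ne', h.1⟩, h.2⟩, fun h => ⟨h.1.2, h.2⟩⟩
  rw [hnbr, add_comm #_, card_filter_add_card_filter_not, card_erase_add_one hx]

theorem upInjective_indepComplex (hx : x ∈ V) (hd : UpInjective k (indepComplex Γ (V.erase x)) i)
    (hl : ∀ j, j + 1 = i → UpInjective k (indepComplex Γ {v ∈ V.erase x | ¬ Γ.Adj x v}) j) :
    UpInjective k (indepComplex Γ V) i :=
  .of_deletion_vertexLink (x := x) (fun _ => mem_indepComplex_of_insert_mem)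
    (by rwa [deletion_indepComplex]) (by rwa [vertexLink_indepComplex hx])

theorem upSurjective_indepComplex (hx : x ∈ V)
    (hd : UpSurjective k (indepComplex Γ (V.erase x)) (i + 1))
    (hl : UpSurjective k (indepComplex Γ {v ∈ V.erase x | ¬ Γ.Adj x v}) i) :
    UpSurjective k (indepComplex Γ V) (i + 1) :=
  .of_deletion_vertexLink (x := x) (by rwa [deletion_indepComplex])
    (by rwa [vertexLink_indepComplex hx])

theorem upInjective_indepComplex_star (hV : ((#V).factorial : k) ≠ 0) (hx : x ∈ V)
    (hindep : Γ.IsIndepSet (V.erase x)) (hdeg : #{v ∈ V | Γ.Adj x v} ≤ 2)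
    (hi : 2 * i + 1 < #V) : UpInjective k (indepComplex Γ V) i := by
  have hcard := card_nonneighbors_add_card_neighbors (Γ := Γ) hx
  have herase := card_erase_add_one hx
  have hsub : ({v ∈ V.erase x | ¬ Γ.Adj x v} : Finset α) ⊆ V.erase x := filter_subset _ _
  refine upInjective_indepComplex hx ?_ fun j hj => ?_
  · rw [indepComplex_of_isIndepSet hindep]
    exact upInjective_subsets (factorial_card_ne_zero_of_subset (erase_subset x V) hV) (by omega)
  · rw [indepComplex_of_isIndepSet (hindep.mono (coe_subset.2 hsub))]
    exact upInjective_subsets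
      (factorial_card_ne_zero_of_subset (hsub.trans (erase_subset x V)) hV) (by omega)

theorem upSurjective_indepComplex_star (hV : ((#V).factorial : k) ≠ 0) (hx : x ∈ V)
    (hindep : Γ.IsIndepSet (V.erase x)) (hdeg : 1 ≤ #{v ∈ V | Γ.Adj x v})
    (hi : #V ≤ 2 * i + 1) : UpSurjective k (indepComplex Γ V) i := by
  have hcard := card_nonneighbors_add_card_neighbors (Γ := Γ) hx
  have herase := card_erase_add_one hx
  have hsub : ({v ∈ V.erase x | ¬ Γ.Adj x v} : Finset α) ⊆ V.erase x := filter_subset _ _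
  obtain ⟨i, rfl⟩ : ∃ j, i = j + 1 := Nat.exists_eq_add_one.2 (by omega)
  refine upSurjective_indepComplex hx ?_ ?_
  · rw [indepComplex_of_isIndepSet hindep]
    exact upSurjective_subsets (factorial_card_ne_zero_of_subset (erase_subset x V) hV) (by omega)
  · rw [indepComplex_of_isIndepSet (hindep.mono (coe_subset.2 hsub))]
    exact upSurjective_subsets
      (factorial_card_ne_zero_of_subset (hsub.trans (erase_subset x V)) hV) (by omega)

end IndependenceComplex

section TwoEdges

open Finset

variable {α : Type*} {Γ : SimpleGraph α} {e e' : Sym2 α} {p r s : α} {V : Finset α}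

theorem adj_iff_eq_of_edgeSet_eq_pair (hE : Γ.edgeSet = {e, s(r, s)}) (hr : r ∉ e) (v : α) :
    Γ.Adj r v ↔ v = s := by
  rw [← SimpleGraph.mem_edgeSet, hE, Set.mem_insert_iff, Set.mem_singleton_iff, Sym2.congr_right]
  refine or_iff_right ?_
  rintro rfl
  exact hr (Sym2.mem_mk_left r v)

variable [DecidableEq α]

theorem isIndepSet_erase_of_edgeSet_eq_pair (hE : Γ.edgeSet = {e, s(r, s)}) (hp : p ∈ e)
    (hpV : p ∉ V) : Γ.IsIndepSet (V.erase r) := by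
  refine isIndepSet_of_forall_edge ?_
  rw [hE]
  rintro _ (rfl | rfl)
  exacts [⟨p, hp, by simp [hpV]⟩, ⟨r, by simp⟩]

variable {k : Type*} [Field k] {i : ℕ}

theorem upInjective_indepComplex_of_notMem (hV : ((#V).factorial : k) ≠ 0)
    (hE : Γ.edgeSet = {e, s(r, s)}) (hp : p ∈ e) (hpV : p ∉ V) (hr : r ∉ e) (hrV : r ∈ V)
    (hi : 2 * i + 1 < #V) : UpInjective k (indepComplex Γ V) i := by
  classical
  refine upInjective_indepComplex_star hV hrV (isIndepSet_erase_of_edgeSet_eq_pair hE hp hpV) ?_ hi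
  simp only [adj_iff_eq_of_edgeSet_eq_pair hE hr, filter_eq']
  split_ifs <;> simp

theorem upSurjective_indepComplex_of_notMem (hV : ((#V).factorial : k) ≠ 0)
    (hE : Γ.edgeSet = {e, s(r, s)}) (hp : p ∈ e) (hpV : p ∉ V) (hr : r ∉ e) (hrV : r ∈ V)
    (hsV : s ∈ V) (hi : #V ≤ 2 * i + 1) : UpSurjective k (indepComplex Γ V) i := by
  classical
  refine upSurjective_indepComplex_star hV hrV (isIndepSet_erase_of_edgeSet_eq_pair hE hp hpV) ?_ hi
  simp [adj_iff_eq_of_edgeSet_eq_pair hE hr, filter_eq', hsV]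

variable [Fintype α]

theorem maximalRank_of_common_vertex {x q : α} (hk : ((Fintype.card α).factorial : k) ≠ 0)
    (hE : Γ.edgeSet = {s(x, q), s(x, s)}) (i : ℕ) :
    UpInjective k (indepComplex Γ univ) i ∨ UpSurjective k (indepComplex Γ univ) i := by
  classical
  have hindep : Γ.IsIndepSet ((univ : Finset α).erase x) :=
    isIndepSet_of_forall_edge (by simp [hE])
  have hnbr : ({v | Γ.Adj x v} : Finset α) = {q, s} := by
    have hxq : Γ.Adj x q := by simp [← SimpleGraph.mem_edgeSet, hE]
    have hxs : Γ.Adj x s := by simp [← SimpleGraph.mem_edgeSet, hE]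
    ext v
    simp [← SimpleGraph.mem_edgeSet, hE, hxq.ne, hxs.ne]
  have hpos : 0 < #{v | Γ.Adj x v} := by simp [hnbr]
  rcases lt_or_ge (2 * i + 1) (Fintype.card α) with hi | hi
  · exact .inl (upInjective_indepComplex_star hk (mem_univ x) hindep (hnbr ▸ card_le_two) hi)
  · exact .inr (upSurjective_indepComplex_star hk (mem_univ x) hindep hpos hi)

theorem maximalRank_of_disjoint_edges {q : α} (hk : ((Fintype.card α).factorial : k) ≠ 0)
    (hodd : Odd (Fintype.card α)) (hE : Γ.edgeSet = {s(p, q), s(r, s)})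
    (hdisj : ∀ v ∈ s(p, q), v ∉ s(r, s)) (i : ℕ) :
    UpInjective k (indepComplex Γ univ) i ∨ UpSurjective k (indepComplex Γ univ) i := by
  classical
  obtain ⟨⟨hpr, hps⟩, hqr, hqs⟩ : (p ≠ r ∧ p ≠ s) ∧ q ≠ r ∧ q ≠ s := by simpa using hdisj
  have hp (v : α) : Γ.Adj p v ↔ v = q :=
    adj_iff_eq_of_edgeSet_eq_pair (hE.trans (Set.pair_comm _ _)) (by simp [hpr, hps]) v
  have hfact (W : Finset α) : ((#W).factorial : k) ≠ 0 :=
    factorial_card_ne_zero_of_subset (subset_univ W) hk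
  have hdel : #(univ.erase p) + 1 = Fintype.card α := card_erase_add_one (mem_univ p)
  have hlink : #{v ∈ univ.erase p | ¬ Γ.Adj p v} + 2 = Fintype.card α := by
    have hpdeg : #{v | Γ.Adj p v} = 1 := by simp [hp, filter_eq']
    have := card_nonneighbors_add_card_neighbors (Γ := Γ) (mem_univ p)
    rwa [hpdeg] at this
  have hpe : p ∈ s(p, q) := Sym2.mem_mk_left p q
  have hre : r ∉ s(p, q) := by simp [hpr.symm, hqr.symm]
  have hparity : Fintype.card α ≠ 2 * i + 2 := fun h => by grind
  rcases lt_or_gt_of_ne hparity with hi | hi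
  · have hcard : #{p, r} ≤ Fintype.card α := card_le_univ _
    rw [card_pair hpr] at hcard
    obtain ⟨i, rfl⟩ : ∃ j, i = j + 1 := Nat.exists_eq_add_one.2 (by omega)
    exact .inr <| upSurjective_indepComplex (mem_univ p)
      (upSurjective_indepComplex_of_notMem (hfact _) hE hpe (by simp) hre (by simp [hpr.symm])
        (by simp [hps.symm]) (by omega))
      (upSurjective_indepComplex_of_notMem (hfact _) hE hpe (by simp) hre
        (by simp [hp, hpr.symm, hqr.symm]) (by simp [hp, hps.symm, hqs.symm]) (by omega))
  · exact .inl <| upInjective_indepComplex (mem_univ p)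
      (upInjective_indepComplex_of_notMem (hfact _) hE hpe (by simp) hre (by simp [hpr.symm])
        (by omega))
      fun j hj => upInjective_indepComplex_of_notMem (hfact _) hE hpe (by simp) hre
        (by simp [hp, hpr.symm, hqr.symm]) (by omega)

theorem maximalRank_of_edgeSet_eq_pair (hk : ((Fintype.card α).factorial : k) ≠ 0)
    (hodd : Odd (Fintype.card α)) (hE : Γ.edgeSet = {e, e'}) (i : ℕ) :
    UpInjective k (indepComplex Γ univ) i ∨ UpSurjective k (indepComplex Γ univ) i := by
  by_cases h : ∃ x, x ∈ e ∧ x ∈ e'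
  · obtain ⟨x, ⟨q, rfl⟩, s, rfl⟩ := h
    exact maximalRank_of_common_vertex hk hE i
  · induction e with | _ p q
    induction e' with | _ r s
    exact maximalRank_of_disjoint_edges hk hodd hE (by grind) i

end TwoEdges

section Exponents

open Finset

variable {σ : Type*} [DecidableEq σ]

/-- The exponent vector of the squarefree monomial `∏ v ∈ S, x_v`. -/
def squarefreeExponent (S : Finset σ) : σ →₀ ℕ := Multiset.toFinsupp S.val

theorem squarefreeExponent_apply (S : Finset σ) (v : σ) :
    squarefreeExponent S v = if v ∈ S then 1 else 0 := by
  rw [squarefreeExponent, Multiset.toFinsupp_apply, Multiset.count_eq_of_nodup S.nodup]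
  rfl

theorem squarefreeExponent_injective :
    Function.Injective (squarefreeExponent : Finset σ → σ →₀ ℕ) :=
  Multiset.toFinsupp.injective.comp val_injective

theorem degree_squarefreeExponent (S : Finset σ) : (squarefreeExponent S).degree = #S :=
  Multiset.toFinsupp_sum_eq S.val

theorem squarefreeExponent_sub_single (S : Finset σ) (v : σ) :
    squarefreeExponent S - Finsupp.single v 1 = squarefreeExponent (S.erase v) := by
  ext w
  rw [Finsupp.tsub_apply, squarefreeExponent_apply, squarefreeExponent_apply, Finsupp.single_apply]
  grind

theorem squarefreeExponent_support {d : σ →₀ ℕ} (hd : ∀ v, d v ≤ 1) :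
    squarefreeExponent d.support = d := by
  ext v
  have := hd v
  rw [squarefreeExponent_apply]
  split_ifs with hv <;> rw [Finsupp.mem_support_iff] at hv <;> omega

/-- The exponent vector of the quadratic monomial `x_a * x_b` for the unordered pair `s(a, b)`. -/
def quadricExponent (e : Sym2 σ) : σ →₀ ℕ := Multiset.toFinsupp e.toMultiset

theorem quadricExponent_diag (v : σ) : quadricExponent s(v, v) = Finsupp.single v 2 := by
  rw [quadricExponent, Multiset.toFinsupp_eq_iff, Finsupp.toMultiset_single]
  rfl

theorem quadricExponent_injective : Function.Injective (quadricExponent : Sym2 σ → σ →₀ ℕ) := by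
  refine Multiset.toFinsupp.injective.comp fun e e' h => (Sym2.equivMultiset σ).injective ?_
  induction e
  induction e'
  exact Subtype.ext h

theorem mem_range_quadricExponent {m : σ →₀ ℕ} (hm : m.degree = 2) :
    m ∈ Set.range (quadricExponent : Sym2 σ → σ →₀ ℕ) := by
  obtain ⟨a, b, hab⟩ := Multiset.card_eq_two.1 ((Finsupp.card_toMultiset m).trans hm)
  exact ⟨s(a, b), Multiset.toFinsupp_eq_iff.2 hab.symm⟩

theorem quadricExponent_le_squarefreeExponent_iff {a b : σ} {S : Finset σ} :
    quadricExponent s(a, b) ≤ squarefreeExponent S ↔ a ≠ b ∧ a ∈ S ∧ b ∈ S := by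
  have hle : quadricExponent s(a, b) ≤ squarefreeExponent S ↔ {a, b} ≤ S.val :=
    Finsupp.orderIsoMultiset.symm.le_iff_le
  have hnodup : ({a, b} : Multiset σ).Nodup ↔ a ≠ b := by simp
  have hsub : ({a, b} : Multiset σ) ⊆ S.val ↔ a ∈ S ∧ b ∈ S := by simp [Multiset.subset_iff]
  rw [hle, ← hnodup, ← hsub]
  exact ⟨fun h => ⟨Multiset.nodup_of_le h S.nodup, Multiset.subset_of_le h⟩,
    fun h => (Multiset.le_iff_subset h.1).2 h.2⟩

/-- The supports of the squarefree monomials divisible by no monomial with exponent in `G`. -/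
def standardSupports (G : Finset (σ →₀ ℕ)) : Set (Finset σ) :=
  {S | ∀ m ∈ G, ¬ m ≤ squarefreeExponent S}

/-- The graph on the variables whose edges are the squarefree quadratic monomials in `G`. -/
def quadricGraph (G : Finset (σ →₀ ℕ)) : SimpleGraph σ :=
  SimpleGraph.fromEdgeSet (quadricExponent ⁻¹' (G : Set (σ →₀ ℕ)))

variable [Fintype σ] {G : Finset (σ →₀ ℕ)}

theorem standardSupports_eq_indepComplex (hdeg : ∀ m ∈ G, m.degree = 2) :
    standardSupports G = indepComplex (quadricGraph G) univ := by
  ext S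
  refine ⟨fun hS => ⟨subset_univ S, fun a ha b hb hab hadj => ?_⟩, fun hS m hm hle => ?_⟩
  · exact hS _ ((SimpleGraph.fromEdgeSet_adj _).1 hadj).1
      (quadricExponent_le_squarefreeExponent_iff.2 ⟨hab, ha, hb⟩)
  · obtain ⟨⟨a, b⟩, rfl⟩ := mem_range_quadricExponent (hdeg m hm)
    obtain ⟨hab, ha, hb⟩ := quadricExponent_le_squarefreeExponent_iff.1 hle
    exact hS.2 ha hb hab ((SimpleGraph.fromEdgeSet_adj _).2 ⟨hm, hab⟩)

theorem ncard_edgeSet_quadricGraph (hdeg : ∀ m ∈ G, m.degree = 2)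
    (hsq : ∀ v, Finsupp.single v 2 ∈ G) :
    (quadricGraph G).edgeSet.ncard = #G - Fintype.card σ := by
  have hdiag : Sym2.diagSet ⊆ quadricExponent ⁻¹' (G : Set (σ →₀ ℕ)) := by
    rw [← Sym2.range_diag, Set.range_subset_iff]
    intro v
    rw [Set.mem_preimage, Sym2.diag, quadricExponent_diag]
    exact hsq v
  rw [quadricGraph, SimpleGraph.edgeSet_fromEdgeSet, Set.ncard_sdiff hdiag, Sym2.ncard_diagSet,
    Nat.card_eq_fintype_card, Set.ncard_preimage_of_injective_subset_range
      quadricExponent_injective fun m hm => mem_range_quadricExponent (hdeg m hm),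
    Set.ncard_coe_finset]

end Exponents

section MonomialQuotient

open Finset

variable {k : Type*} [Field k] {n : ℕ} {G : Finset (Fin n →₀ ℕ)}

theorem coeff_squarefreeExponent_sum_X_mul (T : Finset (Fin n)) (p : MvPolynomial (Fin n) k) :
    coeff (squarefreeExponent T) ((∑ j, X j) * p) =
      ∑ v ∈ T, coeff (squarefreeExponent (T.erase v)) p := by
  rw [sum_mul, coeff_sum, ← sum_subset (subset_univ T)]
  · refine sum_congr rfl fun v hv => ?_
    rw [coeff_X_mul', if_pos (by simp [squarefreeExponent_apply, hv]),
      squarefreeExponent_sub_single]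
  · intro v _ hv
    rw [coeff_X_mul', if_neg (by simp [squarefreeExponent_apply, hv])]

theorem mem_monomialIdeal_iff (hsq : ∀ j, Finsupp.single j 2 ∈ G) {p : MvPolynomial (Fin n) k} :
    p ∈ monomialIdeal k G ↔ ∀ S ∈ standardSupports G, coeff (squarefreeExponent S) p = 0 := by
  rw [monomialIdeal, mem_ideal_span_monomial_image]
  refine ⟨fun h S hS => ?_, fun h d hd => ?_⟩
  · by_contra hc
    obtain ⟨m, hm, hle⟩ := h _ (mem_support_iff.2 hc)
    exact hS m hm hle
  · by_contra! hstd
    have hd1 (j : Fin n) : d j ≤ 1 := by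
      by_contra! hj
      exact hstd _ (hsq j) (Finsupp.single_le_iff.2 hj)
    rw [← squarefreeExponent_support hd1] at hd hstd
    exact mem_support_iff.1 hd (h _ hstd)

theorem sum_X_mem_quotPiece (I : Ideal (MvPolynomial (Fin n) k)) :
    Ideal.Quotient.mk I (∑ j, X j) ∈ quotPiece I 1 :=
  ⟨∑ j, X j, IsHomogeneous.sum _ _ _ fun j _ => isHomogeneous_X k j, rfl⟩

theorem injective_mulLinearForm_sum_X (hsq : ∀ j, Finsupp.single j 2 ∈ G) {i : ℕ}
    (h : UpInjective k (standardSupports G) i) :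
    Function.Injective (mulLinearForm (monomialIdeal k G) _ (sum_X_mem_quotPiece _) i) := by
  rw [injective_iff_map_eq_zero]
  rintro ⟨_, p, hp, rfl⟩ h0
  have hmem : (∑ j, X j) * p ∈ monomialIdeal k G := by
    rw [← Ideal.Quotient.eq_zero_iff_mem, map_mul]
    exact congrArg Subtype.val h0
  rw [mem_monomialIdeal_iff hsq] at hmem
  refine Subtype.ext (Ideal.Quotient.eq_zero_iff_mem.2 ((mem_monomialIdeal_iff hsq).2 ?_))
  intro S hS
  by_cases hSi : #S = i
  · refine h (fun S => coeff (squarefreeExponent S) p) (fun T hT _ => ?_) S hS hSi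
    rw [← coeff_squarefreeExponent_sum_X_mul]
    exact hmem T hT
  · exact IsHomogeneous.coeff_eq_zero hp (by rwa [degree_squarefreeExponent])

theorem exists_isHomogeneous_coeff_squarefreeExponent (i : ℕ) (f : Finset (Fin n) → k) :
    ∃ p : MvPolynomial (Fin n) k, p.IsHomogeneous i ∧
      ∀ S : Finset (Fin n), #S = i → coeff (squarefreeExponent S) p = f S := by
  refine ⟨∑ S with #S = i, monomial (squarefreeExponent S) (f S),
    IsHomogeneous.sum _ _ _ fun S hS => isHomogeneous_monomial _ ?_, fun S hS => ?_⟩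
  · rw [degree_squarefreeExponent, (mem_filter.1 hS).2]
  · simp only [coeff_sum, coeff_monomial, squarefreeExponent_injective.eq_iff]
    simp [hS]

theorem surjective_mulLinearForm_sum_X (hsq : ∀ j, Finsupp.single j 2 ∈ G) {i : ℕ}
    (h : UpSurjective k (standardSupports G) i) :
    Function.Surjective (mulLinearForm (monomialIdeal k G) _ (sum_X_mem_quotPiece _) i) := by
  rintro ⟨_, q, hq, rfl⟩
  obtain ⟨f, hf⟩ := h fun S => coeff (squarefreeExponent S) q
  obtain ⟨p, hp, hpf⟩ := exists_isHomogeneous_coeff_squarefreeExponent i f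
  refine ⟨⟨Ideal.Quotient.mk _ p, p, hp, rfl⟩, Subtype.ext ?_⟩
  change Ideal.Quotient.mk _ (∑ j, X j) * Ideal.Quotient.mk _ p = Ideal.Quotient.mk _ q
  rw [← map_mul, Ideal.Quotient.eq, mem_monomialIdeal_iff hsq]
  intro T hT
  by_cases hTi : #T = i + 1
  · rw [coeff_sub, sub_eq_zero, coeff_squarefreeExponent_sum_X_mul, ← hf T hT hTi]
    refine sum_congr rfl fun v hv => hpf _ ?_
    rw [card_erase_of_mem hv, hTi, Nat.add_sub_cancel]
  · have hmul : ((∑ j, X j) * p).IsHomogeneous (i + 1) := by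
      rw [add_comm]
      exact (IsHomogeneous.sum _ _ _ fun j _ => isHomogeneous_X k j).mul hp
    exact (hmul.sub hq).coeff_eq_zero (by rwa [degree_squarefreeExponent])

theorem hasWLP_of_maximalRank (hsq : ∀ j, Finsupp.single j 2 ∈ G)
    (h : ∀ i, UpInjective k (standardSupports G) i ∨ UpSurjective k (standardSupports G) i) :
    HasWLP (monomialIdeal k G) :=
  ⟨_, sum_X_mem_quotPiece _, fun i =>
    (h i).imp (injective_mulLinearForm_sum_X hsq) (surjective_mulLinearForm_sum_X hsq)⟩

theorem exists_single_mem_of_isArtinianRing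
    (hart : IsArtinianRing (MvPolynomial (Fin n) k ⧸ monomialIdeal k G)) (j : Fin n) :
    ∃ a, Finsupp.single j a ∈ G := by
  obtain ⟨N, y, hy⟩ := IsArtinian.exists_pow_succ_smul_dvd
    (Ideal.Quotient.mk (monomialIdeal k G) (X j)) (1 : MvPolynomial (Fin n) k ⧸ monomialIdeal k G)
  obtain ⟨q, rfl⟩ := Ideal.Quotient.mk_surjective y
  rw [smul_eq_mul, smul_eq_mul, mul_one, ← map_pow, ← map_pow, ← map_mul, Ideal.Quotient.eq,
    monomialIdeal, mem_ideal_span_monomial_image] at hy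
  have hcoeff :
      coeff (Finsupp.single j N) (X j ^ (N + 1) * q - X j ^ N : MvPolynomial _ k) ≠ 0 := by
    have hnle : ¬ Finsupp.single j (N + 1) ≤ Finsupp.single j N := fun h => by simpa using h j
    rw [coeff_sub, X_pow_eq_monomial, X_pow_eq_monomial, coeff_monomial_mul', if_neg hnle,
      coeff_monomial, if_pos rfl]
    simp
  obtain ⟨m, hm, hle⟩ := hy _ (mem_support_iff.2 hcoeff)
  obtain ⟨a, rfl⟩ := Finsupp.support_subset_singleton'.1
    ((Finsupp.support_mono hle).trans Finsupp.support_single_subset)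
  exact ⟨a, hm⟩

theorem single_mem_of_isArtinianRing {d : ℕ} (hdeg : ∀ m ∈ G, m.degree = d)
    (hart : IsArtinianRing (MvPolynomial (Fin n) k ⧸ monomialIdeal k G)) (j : Fin n) :
    Finsupp.single j d ∈ G := by
  obtain ⟨a, ha⟩ := exists_single_mem_of_isArtinianRing hart j
  have had := hdeg _ ha
  rw [Finsupp.degree_single] at had
  exact had ▸ ha

end MonomialQuotient

theorem proposition6p5_general {k : Type*} [Field k] (n : ℕ) (hk : (n.factorial : k) ≠ 0)
    (hodd : Odd n) (I : Ideal (MvPolynomial (Fin n) k))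
    (hart : IsArtinianRing (MvPolynomial (Fin n) k ⧸ I))
    (hI : IsMinGenByMonomials I (n + 2) 2) : HasWLP I := by
  obtain ⟨G, hcard, hdeg, rfl, -⟩ := hI
  have hsq := single_mem_of_isArtinianRing hdeg hart
  have hedges : (quadricGraph G).edgeSet.ncard = 2 := by
    rw [ncard_edgeSet_quadricGraph hdeg hsq, hcard, Fintype.card_fin, Nat.add_sub_cancel_left]
  obtain ⟨e, e', -, hE⟩ := Set.ncard_eq_two.1 hedges
  refine hasWLP_of_maximalRank hsq fun i => ?_
  rw [standardSupports_eq_indepComplex hdeg]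
  exact maximalRank_of_edgeSet_eq_pair (by rwa [Fintype.card_fin]) (by rwa [Fintype.card_fin]) hE i

end

theorem proposition6p5 {k : Type*} [Field k] [CharZero k] (n : ℕ) (hn : 5 ≤ n) (hodd : Odd n)
    (I : Ideal (MvPolynomial (Fin n) k))
    (hart : IsArtinianRing (MvPolynomial (Fin n) k ⧸ I))
    (hI : IsMinGenByMonomials I (n + 2) 2) :
    HasWLP I :=
  proposition6p5_general n (Nat.cast_ne_zero.2 n.factorial_ne_zero) hodd I hart hI
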